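/- Let $n\ge 1$, let $B$ be the closed Euclidean unit ball of $\mathbb{R}^n$ and $e_1=(1,0,\dots,0)$. Let $\mathrm{Lsc}(\mathbb{R}^n)$ be the set of lower semicontinuous functions $\phi:\mathbb{R}^n\to[-\infty,\infty]$, and write $\mathrm{epi}(\phi)=\{(x,s)\in\mathbb{R}^n\times\mathbb{R}:\phi(x)\le s\}$ and $G_\phi(s)=\{x\in\mathbb{R}^n:\phi(x)\le s\}$. The $\tau$-topology on $\mathrm{Lsc}(\mathbb{R}^n)$ is generated by the sets $\{\phi:\mathrm{epi}(\phi)\cap K=\emptyset\}$ with $K\subset\mathbb{R}^{n}\times\mathbb{R}$ compact and $\{\phi:\mathrm{epi}(\phi)\cap G\ne\emptyset\}$ with $G\subset\mathbb{R}^{n}\times\mathbb{R}$ open; thus $\phi_m\to\phi$ in $\tau$ if and only if $\limsup_m\mathrm{epi}(\phi_m)\subset\mathrm{epi}(\phi)\subset\liminf_m\mathrm{epi}(\phi_m)$. Let $\mathrm{Cvx}(\mathbb{R}^n)$ be the set of lower semicontinuous proper convex functions $\phi:\mathbb{R}^n\to\mathbb{R}\cup\{\infty\}$, let $\mathrm{Cvx}_0=\{\phi\in\mathrm{Cvx}(\mathbb{R}^n):\phi\ge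 0,\ \phi(0)=0\}$ and $\mathrm{Cvx}^+=\{\phi\in\mathrm{Cvx}(\mathbb{R}^n):0<\int_{\mathbb{R}^n}e^{-\phi(x)}\,dx<\infty\}$. Put $$\mathscr{S}_1=\bigcup_{0\le t\le n}\{\phi\in\mathrm{Cvx}_0:\ te_1+B\subset G_\phi(1)\subset 2nB\},\qquad \mathscr{S}_{1,c}=\Big\{\phi\in\mathscr{S}_1:\ \int_{\mathbb{R}^n}x\,e^{-\phi(x)}\,dx=0\Big\}$$ (so $\mathscr{S}_{1,c}$ consists of the members of $\mathscr{S}_1$ with centroid $0$), and $$\mathscr{S}_2=\bigcup_{0\le t\le n}\{\phi\in\mathrm{Cvx}^+:\ te_1+B\subset G_\phi(2n)\subset 2nB,\ \inf\phi=0,\ 0\le\phi(0)\le n\}.$$ Then each of $\mathscr{S}_1$, $\mathscr{S}_{1,c}$ and $\mathscr{S}_2$ is closed in $\mathrm{Lsc}(\mathbb{R}^n)$ with respect to $\tau$, and is compact in $\tau$. -/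

import Mathlib

open Set Filter Topology MeasureTheory

noncomputable section

namespace BlaschkeSantalo

/-- `ℝⁿ` with its Euclidean norm. -/
abbrev E (n : ℕ) : Type := EuclideanSpace ℝ (Fin n)

/-! ### Semi-limits of sequences of sets -/

/-- The upper limit of a sequence of sets: all limits of sequences `x_{m_j} ∈ K_{m_j}` along
subsequences `m_0 < m_1 < …`. -/
def limsupSet {X : Type*} [TopologicalSpace X] (K : ℕ → Set X) : Set X :=
  {x | ∃ m : ℕ → ℕ, StrictMono m ∧ ∃ u : ℕ → X, (∀ j, u j ∈ K (m j)) ∧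
    Tendsto u atTop (𝓝 x)}

/-- The lower limit of a sequence of sets: all limits of sequences `x_m` with `x_m ∈ K_m` for all
but finitely many `m`. -/
def liminfSet {X : Type*} [TopologicalSpace X] (K : ℕ → Set X) : Set X :=
  {x | ∃ M : ℕ, ∃ u : ℕ → X, (∀ m, M < m → u m ∈ K m) ∧ Tendsto u atTop (𝓝 x)}

/-- `K_m → L` in the `τ`-topology: `limsup K_m ⊆ L ⊆ liminf K_m`. -/
def TauConvergesSet {X : Type*} [TopologicalSpace X] (K : ℕ → Set X) (L : Set X) : Prop :=
  limsupSet K ⊆ L ∧ L ⊆ liminfSet K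

/-! ### Lower semicontinuous functions and the `τ`-topology -/

/-- Lower semicontinuous functions `ℝⁿ → [-∞, ∞]`. -/
structure LscFun (n : ℕ) where
  toFun : E n → EReal
  lsc' : LowerSemicontinuous toFun

instance (n : ℕ) : CoeFun (LscFun n) (fun _ => E n → EReal) := ⟨LscFun.toFun⟩

/-- The epigraph of `φ`, a closed subset of `ℝⁿ × ℝ`. -/
def LscFun.epi {n : ℕ} (φ : LscFun n) : Set (E n × ℝ) :=
  {p | φ p.1 ≤ (p.2 : EReal)}

/-- The sub-level set `G_φ(s)`. -/
def LscFun.sublevel {n : ℕ} (φ : LscFun n) (s : ℝ) : Set (E n) :=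
  {x | φ x ≤ (s : EReal)}

/-- The `τ`-topology on lower semicontinuous functions, which are identified with their epigraphs:
it is generated by the sets `{φ | epi φ ∩ K = ∅}` with `K` compact and
`{φ | epi φ ∩ G ≠ ∅}` with `G` open. -/
instance tauTopology (n : ℕ) : TopologicalSpace (LscFun n) :=
  TopologicalSpace.generateFrom
    ({U | ∃ K : Set (E n × ℝ), IsCompact K ∧ U = {φ : LscFun n | φ.epi ∩ K = ∅}} ∪
      {U | ∃ G : Set (E n × ℝ), IsOpen G ∧ U = {φ : LscFun n | (φ.epi ∩ G).Nonempty}})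

theorem LscFun.isClosed_epi {n : ℕ} (φ : LscFun n) : IsClosed φ.epi := by
  have h := φ.lsc'.isClosed_epigraph
  exact h.preimage (f := fun p : E n × ℝ => (p.1, (p.2 : EReal)))
    (continuous_fst.prodMk (continuous_coe_real_ereal.comp continuous_snd))

/-- Convergence of sequences in `tauTopology` is `τ`-convergence of the epigraphs. -/
theorem tendsto_tau_iff {n : ℕ} (φ : ℕ → LscFun n) (ψ : LscFun n) :
    Tendsto φ atTop (𝓝 ψ) ↔ TauConvergesSet (fun m => (φ m).epi) ψ.epi := by
  constructor
  · intro h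
    have h' := TopologicalSpace.tendsto_nhds_generateFrom_iff.1 h
    have hG : ∀ G : Set (E n × ℝ), IsOpen G → (ψ.epi ∩ G).Nonempty →
        ∀ᶠ m in atTop, ((φ m).epi ∩ G).Nonempty :=
      fun G hGo hne => h' _ (Or.inr ⟨G, hGo, rfl⟩) hne
    have hK : ∀ K : Set (E n × ℝ), IsCompact K → ψ.epi ∩ K = ∅ →
        ∀ᶠ m in atTop, (φ m).epi ∩ K = ∅ :=
      fun K hKc hd => h' _ (Or.inl ⟨K, hKc, rfl⟩) hd
    constructor
    · rintro x ⟨m, hm, u, hu, hux⟩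
      by_contra hx
      obtain ⟨K, hKn, hKs, hKc⟩ :=
        local_compact_nhds (ψ.isClosed_epi.isOpen_compl.mem_nhds hx)
      have h1 := hK K hKc (by
        ext y
        simp only [mem_inter_iff, mem_empty_iff_false, iff_false, not_and]
        exact fun hy hyK => hKs hyK hy)
      have h2 := hm.tendsto_atTop.eventually h1
      obtain ⟨j, hj, hjK⟩ := (h2.and (hux.eventually_mem hKn)).exists
      have : u j ∈ (φ (m j)).epi ∩ K := ⟨hu j, hjK⟩
      rw [hj] at this
      exact this
    · intro x hx
      have hne : ∀ ε : ℝ, 0 < ε → ∀ᶠ m in atTop, ∃ y ∈ (φ m).epi, dist x y < ε := by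
        intro ε hε
        filter_upwards [hG (Metric.ball x ε) Metric.isOpen_ball ⟨x, hx, Metric.mem_ball_self hε⟩]
          with m ⟨y, hy, hyb⟩
        exact ⟨y, hy, by rw [dist_comm]; exact hyb⟩
      obtain ⟨M, hM⟩ := eventually_atTop.1 (hne 1 one_pos)
      have hch : ∀ m, ∃ y : E n × ℝ, M < m →
          y ∈ (φ m).epi ∧ dist x y < Metric.infDist x (φ m).epi + 1 / ((m : ℝ) + 1) := by
        intro m
        by_cases hm : M < m
        · obtain ⟨z, hz, -⟩ := hM m hm.le
          obtain ⟨y, hy, hy'⟩ := (Metric.infDist_lt_iff ⟨z, hz⟩).1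
            (lt_add_of_pos_right (Metric.infDist x (φ m).epi)
              (Nat.one_div_pos_of_nat (α := ℝ) (n := m)))
          exact ⟨y, fun _ => ⟨hy, hy'⟩⟩
        · exact ⟨x, fun h => absurd h hm⟩
      choose u hu using hch
      refine ⟨M, u, fun m hm => (hu m hm).1, ?_⟩
      rw [Metric.tendsto_atTop']
      intro ε hε
      obtain ⟨N, hN⟩ := eventually_atTop.1 (hne (ε / 2) (half_pos hε))
      obtain ⟨N', hN'⟩ := eventually_atTop.1
        ((tendsto_one_div_add_atTop_nhds_zero_nat (𝕜 := ℝ)).eventually_lt_const (half_pos hε))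
      refine ⟨max M (max N N'), fun m hm => ?_⟩
      have hm1 : M < m := lt_of_le_of_lt (le_max_left _ _) hm
      have hm2 : N ≤ m := ((le_max_left _ _).trans (le_max_right _ _)).trans hm.le
      have hm3 : N' ≤ m := ((le_max_right _ _).trans (le_max_right _ _)).trans hm.le
      obtain ⟨y, hy, hy'⟩ := hN m hm2
      have := Metric.infDist_le_dist_of_mem (x := x) hy
      have h3 := hN' m hm3
      have h4 := (hu m hm1).2
      rw [dist_comm]
      linarith
  · rintro ⟨h1, h2⟩
    refine TopologicalSpace.tendsto_nhds_generateFrom_iff.2 ?_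
    rintro U (⟨K, hK, rfl⟩ | ⟨G, hG, rfl⟩) hU
    · change ∀ᶠ m in atTop, (φ m).epi ∩ K = ∅
      by_contra hcon
      obtain ⟨m, hm, hmne⟩ := extraction_of_frequently_atTop (not_eventually.1 hcon)
      choose u hu using fun j => nonempty_iff_ne_empty.2 (hmne j)
      obtain ⟨x, hxK, k, hk, hkx⟩ := hK.tendsto_subseq (fun j => (hu j).2)
      have hx : x ∈ ψ.epi := h1 ⟨m ∘ k, hm.comp hk, u ∘ k, fun j => (hu (k j)).1, hkx⟩
      have hxm : x ∈ ψ.epi ∩ K := ⟨hx, hxK⟩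
      rw [show ψ.epi ∩ K = ∅ from hU] at hxm
      exact hxm
    · obtain ⟨x, hx, hxG⟩ := hU
      obtain ⟨M, u, hu, hux⟩ := h2 hx
      change ∀ᶠ m in atTop, ((φ m).epi ∩ G).Nonempty
      filter_upwards [hux.eventually_mem (hG.mem_nhds hxG), eventually_gt_atTop M] with m hm hMm
      exact ⟨u m, hu m hMm, hm⟩

/-! ### Classes of convex functions -/

/-- `Cvx(ℝⁿ)`: closed (that is, lower semicontinuous) proper convex functions; convexity is
convexity of the epigraph. -/
def Cvx (n : ℕ) : Set (LscFun n) :=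
  {φ | Convex ℝ φ.epi ∧ (∀ x, φ x ≠ ⊥) ∧ ∃ x, φ x ≠ ⊤}

/-- `Cvx₀(ℝⁿ)`: geometric convex functions, that is, non-negative ones vanishing at the origin. -/
def Cvx0 (n : ℕ) : Set (LscFun n) :=
  {φ ∈ Cvx n | (∀ x, 0 ≤ φ x) ∧ φ 0 = 0}

/-- The integral `∫ e^{-φ(x)} dx ∈ [0, ∞]`, with `e^{-∞} = 0`. -/
def LscFun.mass {n : ℕ} (φ : LscFun n) : ENNReal :=
  ∫⁻ x, EReal.exp (-φ x)

/-- The first moment `∫ x e^{-φ(x)} dx ∈ ℝⁿ`. -/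
def LscFun.moment {n : ℕ} (φ : LscFun n) : E n :=
  ∫ x, (EReal.exp (-φ x)).toReal • x

/-- `Cvx⁺(ℝⁿ)`: functions in `Cvx(ℝⁿ)` with `0 < ∫ e^{-φ} < ∞`. -/
def CvxPos (n : ℕ) : Set (LscFun n) :=
  {φ ∈ Cvx n | 0 < φ.mass ∧ φ.mass < ⊤}

/-- The first standard basis vector of `ℝⁿ`, `n ≥ 1`. -/
def e1 (n : ℕ) [NeZero n] : E n := EuclideanSpace.single 0 1

/-- `S₁`: functions in `Cvx₀` with `t e₁ + B ⊆ G_φ(1) ⊆ 2n B` for some `t ∈ [0, n]`, where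
`B` is the closed Euclidean unit ball. -/
def S1 (n : ℕ) [NeZero n] : Set (LscFun n) :=
  {φ ∈ Cvx0 n | ∃ t : ℝ, 0 ≤ t ∧ t ≤ n ∧
    Metric.closedBall (t • e1 n) 1 ⊆ φ.sublevel 1 ∧
    φ.sublevel 1 ⊆ Metric.closedBall 0 (2 * n)}

/-- `S₁,c`: functions in `S₁` with `∫ x e^{-φ(x)} dx = 0`, that is, with centroid `0`. (On `S₁` the
integrand is integrable and `0 < ∫ e^{-φ} < ∞`.) -/
def S1c (n : ℕ) [NeZero n] : Set (LscFun n) :=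
  {φ ∈ S1 n | φ.moment = 0}

/-- `S₂`: functions in `Cvx⁺` with `t e₁ + B ⊆ G_φ(2n) ⊆ 2n B` for some `t ∈ [0, n]`,
`inf φ = 0` and `0 ≤ φ(0) ≤ n`. -/
def S2 (n : ℕ) [NeZero n] : Set (LscFun n) :=
  {φ ∈ CvxPos n | ∃ t : ℝ, 0 ≤ t ∧ t ≤ n ∧
    Metric.closedBall (t • e1 n) 1 ⊆ φ.sublevel (2 * n) ∧
    φ.sublevel (2 * n) ⊆ Metric.closedBall 0 (2 * n) ∧
    (⨅ x, φ x) = 0 ∧ 0 ≤ φ 0 ∧ φ 0 ≤ ((n : ℝ) : EReal)}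

end BlaschkeSantalo

end

namespace BlaschkeSantalo

variable {n : ℕ}

/-! All of `LscFun n` is `τ`-compact, so only closedness is at stake; by second countability it can
be tested on sequences. Both `S1` and `S2` reduce to `sublevelClass`, which is closed because
convexity turns the bound on one sub-level set into uniform linear growth
(`mul_norm_le_of_sublevel_subset`), an estimate that survives limits. The growth also makes the mass
finite and dominates the first moments. Since epi-convergent convex functions converge almost
everywhere (`ae_tendsto_of_tendsto`), the moment is continuous along sequences in the class, which
settles `S1c`. -/

theorem LscFun.apply_le_of_mem_epi {φ : LscFun n} {x : E n} {s t : ℝ} (h : (x, s) ∈ φ.epi)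
    (hst : s ≤ t) : (x, t) ∈ φ.epi :=
  le_trans (show φ x ≤ (s : EReal) from h) (EReal.coe_le_coe_iff.2 hst)

/-! ### Compactness and second countability of the `τ`-topology -/

theorem isOpen_setOf_epi_inter_nonempty {G : Set (E n × ℝ)} (hG : IsOpen G) :
    IsOpen {φ : LscFun n | (φ.epi ∩ G).Nonempty} :=
  TopologicalSpace.isOpen_generateFrom_of_mem (Or.inr ⟨G, hG, rfl⟩)

theorem isOpen_setOf_epi_inter_eq_empty {K : Set (E n × ℝ)} (hK : IsCompact K) :
    IsOpen {φ : LscFun n | φ.epi ∩ K = ∅} :=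
  TopologicalSpace.isOpen_generateFrom_of_mem (Or.inl ⟨K, hK, rfl⟩)

/-- The smallest function whose epigraph misses the open set `G`. -/
noncomputable def lscAvoiding (G : Set (E n × ℝ)) (hG : IsOpen G) : LscFun n where
  toFun x := ⨆ s : ℝ, ⨆ _ : (x, s) ∈ G, (s : EReal)
  lsc' := by
    intro x y hy
    simp only [lt_iSup_iff] at hy
    obtain ⟨s, hs, hys⟩ := hy
    have : ∀ᶠ x' in 𝓝 x, (x', s) ∈ G :=
      (Continuous.prodMk_left s).continuousAt.eventually_mem (hG.mem_nhds hs)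
    filter_upwards [this] with x' hx'
    exact hys.trans_le (le_iSup₂_of_le s hx' le_rfl)

theorem lt_lscAvoiding_iff {G : Set (E n × ℝ)} (hG : IsOpen G) {x : E n} {y : EReal} :
    y < lscAvoiding G hG x ↔ ∃ s : ℝ, (x, s) ∈ G ∧ y < s := by
  simp [lscAvoiding, lt_iSup_iff]

theorem lscAvoiding_epi_inter {G : Set (E n × ℝ)} (hG : IsOpen G) :
    (lscAvoiding G hG).epi ∩ G = ∅ := by
  rw [eq_empty_iff_forall_notMem]
  rintro ⟨x, s⟩ ⟨h1, h2⟩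
  obtain ⟨ε, hε, hs⟩ := Metric.isOpen_iff.1 hG _ h2
  refine absurd (show lscAvoiding G hG x ≤ (s : EReal) from h1)
    (not_le.2 ((lt_lscAvoiding_iff hG).2 ⟨s + ε / 2, hs ?_, ?_⟩))
  · rw [Metric.mem_ball, Prod.dist_eq]
    simp [abs_of_pos hε, hε]
  · exact EReal.coe_lt_coe_iff.2 (by linarith)

/-- By Alexander's subbase theorem, covers by generating sets suffice. The function avoiding every
`G` whose hit set is in the cover must lie in a miss set, of some compact `K`. Then above each point
of `K` lies a point of some such `G`; finitely many `G` serve all of `K`, and an epigraph meeting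
`K` hits one of them because it is closed upwards. -/
instance : CompactSpace (LscFun n) := by
  refine ⟨isCompact_generateFrom rfl fun P hP hcov => ?_⟩
  set 𝒢 := {G : Set (E n × ℝ) | IsOpen G ∧ {φ : LscFun n | (φ.epi ∩ G).Nonempty} ∈ P}
  have hG : IsOpen (⋃₀ 𝒢) := isOpen_sUnion fun G h => h.1
  obtain ⟨U, hUP, hU⟩ := hcov (mem_univ (lscAvoiding _ hG))
  have havoid := eq_empty_iff_forall_notMem.1 (lscAvoiding_epi_inter hG)
  rcases hP hUP with ⟨K, hK, rfl⟩ | ⟨G, hGo, rfl⟩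
  · have hsub : K ⊆ ⋃ G : 𝒢, ⋃ δ : {δ : ℝ // 0 < δ}, (fun p : E n × ℝ => (p.1, p.2 + δ.1)) ⁻¹' G.1 := by
      rintro ⟨x, s⟩ hp
      have : (s : EReal) < lscAvoiding _ hG x := by
        by_contra h
        exact eq_empty_iff_forall_notMem.1 hU (x, s) ⟨not_lt.1 h, hp⟩
      obtain ⟨t, ⟨G, hGP, htG⟩, hst⟩ := (lt_lscAvoiding_iff hG).1 this
      have hst := EReal.coe_lt_coe_iff.1 hst
      refine mem_iUnion₂.2 ⟨⟨G, hGP⟩, ⟨t - s, sub_pos.2 hst⟩, ?_⟩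
      simpa using htG
    obtain ⟨F, hF⟩ := hK.elim_finite_subcover _ (fun G => isOpen_iUnion fun δ =>
      G.2.1.preimage (by fun_prop)) hsub
    refine ⟨insert {φ : LscFun n | φ.epi ∩ K = ∅}
      ((fun G : 𝒢 => {φ : LscFun n | (φ.epi ∩ G.1).Nonempty}) '' (F : Set 𝒢)), ?_, ?_, ?_⟩
    · refine insert_subset hUP ?_
      rintro _ ⟨G, -, rfl⟩
      exact G.2.2
    · exact (F.finite_toSet.image _).insert _
    · intro φ _
      by_cases hφ : φ.epi ∩ K = ∅
      · exact ⟨_, mem_insert _ _, hφ⟩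
      · obtain ⟨⟨x, s⟩, hx, hxK⟩ := nonempty_iff_ne_empty.2 hφ
        obtain ⟨G, hGF, hxG⟩ := mem_iUnion₂.1 (hF hxK)
        obtain ⟨δ, hδ⟩ := mem_iUnion.1 hxG
        exact ⟨_, mem_insert_of_mem _ ⟨G, hGF, rfl⟩, (x, s + δ.1),
          LscFun.apply_le_of_mem_epi hx (by linarith [δ.2]), hδ⟩
  · obtain ⟨p, hp, hpG⟩ := hU
    exact (havoid p ⟨hp, G, ⟨hGo, hUP⟩, hpG⟩).elim

/-- A compact set in the complement of a closed set of a locally compact regular space is covered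
by finitely many compact closures of basic open sets in that complement. -/
theorem exists_finite_cover_closure {X : Type*} [TopologicalSpace X] [LocallyCompactSpace X]
    [T2Space X] {B : Set (Set X)} (hB : TopologicalSpace.IsTopologicalBasis B) {K A : Set X}
    (hK : IsCompact K) (hA : IsClosed A) (hAK : A ∩ K = ∅) :
    ∃ F : Set (Set X), F.Finite ∧ F ⊆ B ∧ K ⊆ ⋃ b ∈ F, closure b ∧
      IsCompact (⋃ b ∈ F, closure b) ∧ A ∩ ⋃ b ∈ F, closure b = ∅ := by
  have key : ∃ F : Set (Set X), F.Finite ∧ F ⊆ B ∧ K ⊆ ⋃ b ∈ F, closure b ∧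
      ∀ b ∈ F, IsCompact (closure b) ∧ closure b ⊆ Aᶜ := by
    refine hK.induction_on (p := fun K => ∃ F : Set (Set X), F.Finite ∧ F ⊆ B ∧
      K ⊆ ⋃ b ∈ F, closure b ∧ ∀ b ∈ F, IsCompact (closure b) ∧ closure b ⊆ Aᶜ) ?_ ?_ ?_ ?_
    · exact ⟨∅, finite_empty, empty_subset _, empty_subset _, by simp⟩
    · rintro s t hst ⟨F, h1, h2, h3, h4⟩
      exact ⟨F, h1, h2, hst.trans h3, h4⟩
    · rintro s t ⟨F, h1, h2, h3, h4⟩ ⟨F', h1', h2', h3', h4'⟩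
      refine ⟨F ∪ F', h1.union h1', union_subset h2 h2', ?_, ?_⟩
      · rw [biUnion_union]
        exact union_subset_union h3 h3'
      · rintro b (hb | hb)
        exacts [h4 b hb, h4' b hb]
    · intro x hx
      have hxA : x ∈ Aᶜ := fun h => (eq_empty_iff_forall_notMem.1 hAK) x ⟨h, hx⟩
      obtain ⟨L, hLx, hLA, hL⟩ := local_compact_nhds (hA.isOpen_compl.mem_nhds hxA)
      obtain ⟨b, hb, hxb, hbL⟩ := hB.mem_nhds_iff.1 hLx
      have hcl : closure b ⊆ L := closure_minimal hbL hL.isClosed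
      refine ⟨b, mem_nhdsWithin_of_mem_nhds ((hB.isOpen hb).mem_nhds hxb), {b}, finite_singleton b,
        singleton_subset_iff.2 hb, ?_, ?_⟩
      · simpa using subset_closure
      · rintro _ rfl
        exact ⟨hL.of_isClosed_subset isClosed_closure hcl, hcl.trans hLA⟩
  obtain ⟨F, h1, h2, h3, h4⟩ := key
  refine ⟨F, h1, h2, h3, h1.isCompact_biUnion fun b hb => (h4 b hb).1, ?_⟩
  rw [← disjoint_iff_inter_eq_empty, disjoint_iUnion₂_right]
  exact fun b hb => (subset_compl_iff_disjoint_left.1 (h4 b hb).2)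

instance : SecondCountableTopology (LscFun n) := by
  set B := TopologicalSpace.countableBasis (E n × ℝ) with hBdef
  have hB : TopologicalSpace.IsTopologicalBasis B :=
    TopologicalSpace.isBasis_countableBasis (E n × ℝ)
  have hBc : B.Countable := TopologicalSpace.countable_countableBasis (E n × ℝ)
  set C₁ : Set (Set (LscFun n)) :=
    (fun F : Set (Set (E n × ℝ)) => {φ : LscFun n | φ.epi ∩ ⋃ b ∈ F, closure b = ∅}) ''
      {F | (F.Finite ∧ F ⊆ B) ∧ IsCompact (⋃ b ∈ F, closure b)} with hC₁
  set C₂ : Set (Set (LscFun n)) :=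
    (fun G : Set (E n × ℝ) => {φ : LscFun n | (φ.epi ∩ G).Nonempty}) '' B with hC₂
  refine ⟨⟨C₁ ∪ C₂, Countable.union ?_ (hBc.image _), le_antisymm ?_ ?_⟩⟩
  · exact ((countable_ofPred_finite_subset hBc).mono fun F hF => hF.1).image _
  · refine le_generateFrom ?_
    rintro _ (⟨F, hF, rfl⟩ | ⟨G, hG, rfl⟩)
    · exact isOpen_setOf_epi_inter_eq_empty hF.2
    · exact isOpen_setOf_epi_inter_nonempty (hB.isOpen hG)
  · refine le_generateFrom ?_
    rintro _ (⟨K, hK, rfl⟩ | ⟨G, hG, rfl⟩)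
    · refine (@isOpen_iff_forall_mem_open _ (TopologicalSpace.generateFrom (C₁ ∪ C₂)) _).2 ?_
      intro φ hφ
      obtain ⟨F, h1, h2, h3, h4, h5⟩ := exists_finite_cover_closure hB hK φ.isClosed_epi hφ
      refine ⟨{φ : LscFun n | φ.epi ∩ ⋃ b ∈ F, closure b = ∅}, fun ψ hψ => ?_,
        TopologicalSpace.isOpen_generateFrom_of_mem (Or.inl ⟨F, ⟨⟨h1, h2⟩, h4⟩, rfl⟩), h5⟩
      exact subset_empty_iff.1 ((inter_subset_inter_right _ h3).trans hψ.subset)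
    · refine (@isOpen_iff_forall_mem_open _ (TopologicalSpace.generateFrom (C₁ ∪ C₂)) _).2 ?_
      rintro φ ⟨p, hp, hpG⟩
      obtain ⟨b, hb, hpb, hbG⟩ := hB.mem_nhds_iff.1 (hG.mem_nhds hpG)
      exact ⟨{φ : LscFun n | (φ.epi ∩ b).Nonempty},
        fun ψ hψ => Nonempty.mono (inter_subset_inter_right _ hbG) hψ,
        TopologicalSpace.isOpen_generateFrom_of_mem (Or.inr ⟨b, hb, rfl⟩), p, hp, hpb⟩

/-! ### Epi-convergence of convex functions -/

section Convergence

variable {φ : ℕ → LscFun n} {ψ : LscFun n}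

theorem exists_tendsto_of_mem_epi (h : Tendsto φ atTop (𝓝 ψ)) {p : E n × ℝ} (hp : p ∈ ψ.epi) :
    ∃ u : ℕ → E n × ℝ, (∀ᶠ m in atTop, u m ∈ (φ m).epi) ∧ Tendsto u atTop (𝓝 p) := by
  obtain ⟨M, u, hu, hup⟩ := ((tendsto_tau_iff φ ψ).1 h).2 hp
  exact ⟨u, (eventually_gt_atTop M).mono hu, hup⟩

theorem mem_epi_of_tendsto (h : Tendsto φ atTop (𝓝 ψ)) {u : ℕ → E n × ℝ} {p : E n × ℝ}
    (hu : Tendsto u atTop (𝓝 p)) (hf : ∃ᶠ m in atTop, u m ∈ (φ m).epi) : p ∈ ψ.epi := by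
  obtain ⟨k, hk, hku⟩ := extraction_of_frequently_atTop hf
  exact ((tendsto_tau_iff φ ψ).1 h).1 ⟨k, hk, u ∘ k, hku, hu.comp hk.tendsto_atTop⟩

theorem convex_epi_of_tendsto (h : Tendsto φ atTop (𝓝 ψ)) (hc : ∀ m, Convex ℝ (φ m).epi) :
    Convex ℝ ψ.epi := by
  intro p hp q hq a b ha hb hab
  obtain ⟨u, hu, hup⟩ := exists_tendsto_of_mem_epi h hp
  obtain ⟨v, hv, hvq⟩ := exists_tendsto_of_mem_epi h hq
  refine mem_epi_of_tendsto h ((hup.const_smul a).add (hvq.const_smul b)) (Eventually.frequently ?_)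
  filter_upwards [hu, hv] with m hum hvm using hc m hum hvm ha hb hab

/-- A closed nonempty convex set lies in a half-space through any given point outside it. -/
theorem exists_norm_eq_one_forall_le {X : Type*} [NormedAddCommGroup X] [NormedSpace ℝ X]
    {A : Set X} (hA : Convex ℝ A) (hcl : IsClosed A) (hne : A.Nonempty) {p : X} (hp : p ∉ A) :
    ∃ f : StrongDual ℝ X, ‖f‖ = 1 ∧ ∀ a ∈ A, f a ≤ f p := by
  obtain ⟨f, u, hf, hu⟩ := geometric_hahn_banach_closed_point hA hcl hp
  have hf0 : f ≠ 0 := by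
    rintro rfl
    obtain ⟨a, ha⟩ := hne
    simpa using (hf a ha).trans hu
  refine ⟨‖f‖⁻¹ • f, by simp [norm_smul, hf0], fun a ha => ?_⟩
  simp only [smul_apply, smul_eq_mul]
  exact mul_le_mul_of_nonneg_left ((hf a ha).trans hu).le (by positivity)

/-- If `p` were missed infinitely often, unit functionals separating it from the epigraphs would
subconverge to a unit functional `g` maximal over `ψ.epi` at `p`, which is impossible at an interior
point. -/
theorem eventually_mem_epi_of_mem_interior (h : Tendsto φ atTop (𝓝 ψ))
    (hc : ∀ m, Convex ℝ (φ m).epi) {p : E n × ℝ} (hp : p ∈ interior ψ.epi) :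
    ∀ᶠ m in atTop, p ∈ (φ m).epi := by
  by_contra hcon
  -- Needed only to make the epigraphs eventually nonempty, so that the separating functionals are
  -- nonzero.
  obtain ⟨w, hw, -⟩ := exists_tendsto_of_mem_epi h (interior_subset hp)
  obtain ⟨k, hk, hkp⟩ := extraction_of_frequently_atTop ((not_eventually.1 hcon).and_eventually hw)
  choose f hf1 hf using fun j => exists_norm_eq_one_forall_le (hc (k j)) (φ (k j)).isClosed_epi
    ⟨_, (hkp j).2⟩ (hkp j).1
  obtain ⟨g, hg, l, hl, hlg⟩ := (isCompact_sphere (0 : StrongDual ℝ (E n × ℝ)) 1).tendsto_subseq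
    (fun j => mem_sphere_zero_iff_norm.2 (hf1 j))
  obtain ⟨v, hv⟩ : ∃ v, 0 < g v := by
    by_contra! hneg
    have : g = 0 := by
      refine ContinuousLinearMap.ext fun v => ?_
      exact le_antisymm (hneg v) (by simpa using hneg (-v))
    simp [this] at hg
  have hcont : Tendsto (fun δ : ℝ => p + δ • v) (𝓝[>] 0) (𝓝 p) := by
    have : Tendsto (fun δ : ℝ => p + δ • v) (𝓝 0) (𝓝 (p + (0 : ℝ) • v)) :=
      Continuous.tendsto (by fun_prop) 0
    simpa using this.mono_left nhdsWithin_le_nhds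
  obtain ⟨δ, hδ, hδ0⟩ := ((hcont.eventually_mem (isOpen_interior.mem_nhds hp)).and
    self_mem_nhdsWithin).exists
  obtain ⟨u, hu, hup⟩ := exists_tendsto_of_mem_epi h (interior_subset hδ)
  have hkl : Tendsto (k ∘ l) atTop atTop := (hk.comp hl).tendsto_atTop
  have h1 : Tendsto (fun j => f (l j) (u (k (l j)))) atTop (𝓝 (g (p + δ • v))) :=
    (isBoundedBilinearMap_apply.continuous.tendsto (g, p + δ • v)).comp
      (hlg.prodMk_nhds (hup.comp hkl))
  have h2 : Tendsto (fun j => f (l j) p) atTop (𝓝 (g p)) := 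
    (isBoundedBilinearMap_apply.continuous.tendsto (g, p)).comp (hlg.prodMk_nhds tendsto_const_nhds)
  have h3 := le_of_tendsto_of_tendsto h1 h2
    ((hkl.eventually hu).mono fun j hj => hf (l j) _ hj)
  rw [map_add, map_smul, smul_eq_mul] at h3
  have : 0 < δ * g v := mul_pos hδ0 hv
  linarith

/-- Epi-convergence of convex functions implies almost everywhere convergence. -/
theorem ae_tendsto_of_tendsto (h : Tendsto φ atTop (𝓝 ψ)) (hc : ∀ m, Convex ℝ (φ m).epi) :
    ∀ᵐ x : E n, Tendsto (fun m => φ m x) atTop (𝓝 (ψ x)) := by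
  -- A convex set has null frontier, so by Fubini almost every vertical line meets it in a null set
  -- of heights.
  have hfr : ∀ᵐ p : E n × ℝ ∂((volume : Measure (E n)).prod (volume : Measure ℝ)),
      p ∉ frontier ψ.epi :=
    measure_eq_zero_iff_ae_notMem.1 ((convex_epi_of_tendsto h hc).addHaar_frontier _)
  filter_upwards [Measure.ae_ae_of_ae_prod hfr] with x hx
  rw [tendsto_order]
  constructor
  · intro a ha
    obtain ⟨s, has, hs⟩ := EReal.lt_iff_exists_real_btwn.1 ha
    have : ¬ ∃ᶠ m in atTop, (x, s) ∈ (φ m).epi := fun hfreq =>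
      not_le.2 hs (mem_epi_of_tendsto h tendsto_const_nhds hfreq)
    filter_upwards [not_frequently.1 this] with m hm
    exact has.trans (not_le.1 hm)
  · intro a ha
    obtain ⟨s, hs, hsa⟩ := EReal.lt_iff_exists_real_btwn.1 ha
    obtain ⟨t, hst, hta⟩ := EReal.lt_iff_exists_real_btwn.1 hsa
    -- Heights off the frontier are dense; such an `r` above `s` gives an interior point of the
    -- epigraph.
    obtain ⟨r, hr, hr1, hr2⟩ := (Measure.dense_of_ae hx).exists_between
      (EReal.coe_lt_coe_iff.1 hst)
    have hmem : (x, r) ∈ ψ.epi := LscFun.apply_le_of_mem_epi (show (x, s) ∈ ψ.epi from hs.le) hr1.le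
    have hint : (x, r) ∈ interior ψ.epi := by
      by_contra hcon
      exact hr ⟨subset_closure hmem, hcon⟩
    filter_upwards [eventually_mem_epi_of_mem_interior h hc hint] with m hm
    exact (show φ m x ≤ (r : EReal) from hm).trans_lt
      ((EReal.coe_lt_coe_iff.2 hr2).trans hta)

end Convergence

/-! ### Closedness of the sub-level class -/

/-- Nonnegative convex functions with `φ 0 ≤ c` whose sub-level set at height `h` contains a unit
ball centred on the segment `[0, a e₁]` and lies in the ball of radius `R`. -/
def sublevelClass (n : ℕ) [NeZero n] (c h R a : ℝ) : Set (LscFun n) :=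
  {φ | Convex ℝ φ.epi ∧ (∀ x, 0 ≤ φ x) ∧ φ 0 ≤ (c : EReal) ∧ ∃ t : ℝ, 0 ≤ t ∧ t ≤ a ∧
    Metric.closedBall (t • e1 n) 1 ⊆ φ.sublevel h ∧ φ.sublevel h ⊆ Metric.closedBall 0 R}

/-- A convex function that is at most `c` at the origin and exceeds `h > c` outside a ball grows at
least linearly. -/
theorem mul_norm_le_of_sublevel_subset {φ : LscFun n} {c h R : ℝ} (hconv : Convex ℝ φ.epi)
    (h0 : φ 0 ≤ (c : EReal)) (hch : c < h) (hR : φ.sublevel h ⊆ Metric.closedBall 0 R)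
    {x : E n} {r : ℝ} (hx : φ x ≤ (r : EReal)) : (h - c) * ‖x‖ ≤ R * (max r h - c) := by
  rcases le_or_gt r h with hrh | hrh
  · have : x ∈ Metric.closedBall 0 R := hR (hx.trans (EReal.coe_le_coe_iff.2 hrh))
    rw [max_eq_right hrh, mul_comm R]
    exact mul_le_mul_of_nonneg_left (mem_closedBall_zero_iff.1 this) (by linarith)
  · have hrc : 0 < r - c := by linarith
    have hl0 : 0 ≤ (h - c) / (r - c) := div_nonneg (by linarith) hrc.le
    have hl1 : (h - c) / (r - c) ≤ 1 := (div_le_one hrc).2 (by linarith)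
    -- The point at height `h` on the segment from `(0, c)` to `(x, r)`.
    have hmem : ((h - c) / (r - c)) • ((x, r) : E n × ℝ) +
        (1 - (h - c) / (r - c)) • ((0, c) : E n × ℝ) ∈ φ.epi :=
      hconv (show ((x, r) : E n × ℝ) ∈ φ.epi from hx) (show ((0, c) : E n × ℝ) ∈ φ.epi from h0)
        hl0 (by linarith) (by ring)
    have hval : ((h - c) / (r - c)) * r + (1 - (h - c) / (r - c)) * c = h := by
      field_simp
      ring
    have hle : ((h - c) / (r - c)) • x ∈ φ.sublevel h := by
      simpa [LscFun.epi, LscFun.sublevel, hval] using hmem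
    have hn := mem_closedBall_zero_iff.1 (hR hle)
    rw [norm_smul, Real.norm_of_nonneg hl0, div_mul_eq_mul_div, div_le_iff₀ hrc] at hn
    rwa [max_eq_left hrh.le]

theorem isClosed_sublevelClass [NeZero n] {c h R a : ℝ} (hch : c < h) :
    IsClosed (sublevelClass n c h R a) := by
  refine IsSeqClosed.isClosed fun φ ψ hφ hlim => ?_
  choose hconv hpos h0 t ht0 hta hball hsub using hφ
  refine ⟨convex_epi_of_tendsto hlim hconv, fun x => ?_, ?_, ?_⟩
  · by_contra hx
    obtain ⟨s, hs, hs0⟩ := EReal.lt_iff_exists_real_btwn.1 (not_le.1 hx)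
    obtain ⟨u, hu, hux⟩ := exists_tendsto_of_mem_epi hlim (show (x, s) ∈ ψ.epi from hs.le)
    have hu2 : Tendsto (fun m => (u m).2) atTop (𝓝 s) := (continuous_snd.tendsto _).comp hux
    refine absurd (ge_of_tendsto hu2 (hu.mono fun m hm => ?_)) (not_le.2 (EReal.coe_neg'.1 hs0))
    exact EReal.coe_nonneg.1 ((hpos m _).trans hm)
  · exact mem_epi_of_tendsto hlim (u := fun _ => (0, c)) tendsto_const_nhds
      (Eventually.frequently (Eventually.of_forall h0))
  · obtain ⟨t', ht', k, hk, hkt⟩ := isCompact_Icc.tendsto_subseq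
      (fun m => (⟨ht0 m, hta m⟩ : t m ∈ Icc 0 a))
    refine ⟨t', ht'.1, ht'.2, fun y hy => ?_, fun x hx => ?_⟩
    -- Translating `y` by the difference of the centres puts it in the approximating ball.
    · refine mem_epi_of_tendsto (hlim.comp hk.tendsto_atTop) (p := (y, h))
        (u := fun j => ((y - t' • e1 n) + t (k j) • e1 n, h)) ?_
        (Eventually.frequently (Eventually.of_forall fun j => hball (k j) ?_))
      · refine Tendsto.prodMk_nhds ?_ tendsto_const_nhds
        simpa using (hkt.smul_const (e1 n)).const_add (y - t' • e1 n)
      · simpa [dist_eq_norm] using hy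
    · obtain ⟨u, hu, hux⟩ := exists_tendsto_of_mem_epi hlim (show (x, h) ∈ ψ.epi from hx)
      have hu1 : Tendsto (fun m => (u m).1) atTop (𝓝 x) := (continuous_fst.tendsto _).comp hux
      have hu2 : Tendsto (fun m => (u m).2) atTop (𝓝 h) := (continuous_snd.tendsto _).comp hux
      -- The approximating heights may exceed `h`, so the inclusion in the ball cannot be used
      -- directly; the growth bound is continuous in the height and becomes `‖x‖ ≤ R` at `h`.
      have h1 := le_of_tendsto_of_tendsto (hu1.norm.const_mul (h - c))
        (((hu2.max tendsto_const_nhds).sub_const c).const_mul R)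
        (hu.mono fun m hm => mul_norm_le_of_sublevel_subset (hconv m) (h0 m) hch (hsub m) hm)
      rw [max_self, mul_comm R] at h1
      exact mem_closedBall_zero_iff.2 (le_of_mul_le_mul_left h1 (by linarith))

/-! ### Uniform decay, mass and moment -/

theorem exists_exp_neg_le [NeZero n] {c h R a : ℝ} (hch : c < h) (hh : 0 ≤ h) (hR : 0 < R) (k : ℕ) :
    ∃ C : ℝ, 0 ≤ C ∧ ∀ φ ∈ sublevelClass n c h R a, ∀ x,
      EReal.exp (-φ x) ≤ ENNReal.ofReal (C * (1 + ‖x‖) ^ (-(k : ℝ))) := by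
  set b := (h - c) / R with hb
  have hb0 : 0 < b := div_pos (by linarith) hR
  -- From `exp (-y) ≤ k! / y ^ k` at `y = b * (1 + ‖x‖)`; the factor `exp b` pays for replacing
  -- `‖x‖` by `1 + ‖x‖`.
  refine ⟨Real.exp (h - c + b) * (k.factorial / b ^ k), by positivity, ?_⟩
  rintro φ ⟨hconv, hpos, h0, t, -, -, -, hsub⟩ x
  induction hx : φ x with
  | bot => exact absurd (hpos x) (by simp [hx])
  | top => simp
  | coe r =>
    have hr : 0 ≤ r := EReal.coe_nonneg.1 (hx ▸ hpos x)
    have h1 := mul_norm_le_of_sublevel_subset hconv h0 hch hsub hx.le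
    have h2 : R * (max r h - c) ≤ R * (r + h - c) :=
      mul_le_mul_of_nonneg_left (by linarith [max_le_add_of_nonneg hr hh]) hR.le
    have h3 : b * ‖x‖ ≤ r + h - c := by
      rw [hb, div_mul_eq_mul_div, div_le_iff₀ hR]
      linarith
    rw [← EReal.coe_neg, EReal.exp_coe]
    refine ENNReal.ofReal_le_ofReal ?_
    have hy : 0 < 1 + ‖x‖ := by positivity
    have h4 := Real.pow_div_factorial_le_exp (x := b * (1 + ‖x‖)) (by positivity) k
    have h5 : Real.exp (-(b * (1 + ‖x‖))) ≤ k.factorial / (b * (1 + ‖x‖)) ^ k := by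
      rw [Real.exp_neg, ← inv_div]
      exact inv_anti₀ (by positivity) h4
    calc Real.exp (-r) ≤ Real.exp (h - c + b) * Real.exp (-(b * (1 + ‖x‖))) := by
          rw [← Real.exp_add]
          exact Real.exp_le_exp.2 (by linarith)
      _ ≤ Real.exp (h - c + b) * (k.factorial / (b * (1 + ‖x‖)) ^ k) := by gcongr
      _ = _ := by
          rw [Real.rpow_neg hy.le, Real.rpow_natCast, mul_pow]
          field_simp

theorem measurable_exp_neg (φ : LscFun n) : Measurable fun x => EReal.exp (-φ x) :=
  EReal.measurable_exp.comp (measurable_neg.comp φ.lsc'.measurable)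

theorem mass_lt_top_of_mem_sublevelClass [NeZero n] {c h R a : ℝ} (hch : c < h) (hh : 0 ≤ h)
    (hR : 0 < R) {φ : LscFun n} (hφ : φ ∈ sublevelClass n c h R a) : φ.mass < ⊤ := by
  obtain ⟨C, -, hC⟩ := exists_exp_neg_le (n := n) (a := a) hch hh hR (n + 1)
  refine (lintegral_mono fun x => hC φ hφ x).trans_lt (Integrable.lintegral_lt_top ?_)
  exact (integrable_one_add_norm (by simp)).const_mul C

theorem mass_pos_of_mem_sublevelClass [NeZero n] {c h R a : ℝ} {φ : LscFun n}
    (hφ : φ ∈ sublevelClass n c h R a) : 0 < φ.mass := by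
  obtain ⟨-, -, -, t, -, -, hball, -⟩ := hφ
  rw [LscFun.mass, lintegral_pos_iff_support (measurable_exp_neg φ)]
  refine (Metric.measure_closedBall_pos volume (t • e1 n) one_pos).trans_le
    (measure_mono fun x hx => ?_)
  have : φ x ≤ (h : EReal) := hball hx
  have hne : φ x ≠ ⊤ := (this.trans_lt (EReal.coe_lt_top h)).ne
  simpa [Function.mem_support] using hne

theorem tendsto_moment_of_mem_sublevelClass [NeZero n] {c h R a : ℝ} (hch : c < h) (hh : 0 ≤ h)
    (hR : 0 < R) {φ : ℕ → LscFun n} {ψ : LscFun n} (hφ : ∀ m, φ m ∈ sublevelClass n c h R a)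
    (hlim : Tendsto φ atTop (𝓝 ψ)) : Tendsto (fun m => (φ m).moment) atTop (𝓝 ψ.moment) := by
  -- One power absorbs the factor `‖x‖`; the remaining `n + 1` exceeds the dimension.
  obtain ⟨C, hC0, hC⟩ := exists_exp_neg_le (n := n) (a := a) hch hh hR (n + 2)
  have hψ : ψ ∈ sublevelClass n c h R a :=
    (isClosed_sublevelClass hch).mem_of_tendsto hlim (Eventually.of_forall hφ)
  refine tendsto_integral_of_dominated_convergence
    (fun x => C * (1 + ‖x‖) ^ (-((n + 1 : ℕ) : ℝ))) ?_ ?_ ?_ ?_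
  · exact fun m => ((measurable_exp_neg (φ m)).ennreal_toReal.smul measurable_id).aestronglyMeasurable
  · exact (integrable_one_add_norm (by simp)).const_mul C
  · refine fun m => Eventually.of_forall fun x => ?_
    have hy : 0 < 1 + ‖x‖ := by positivity
    have h1 : (EReal.exp (-φ m x)).toReal ≤ C * (1 + ‖x‖) ^ (-((n + 2 : ℕ) : ℝ)) :=
      ENNReal.toReal_le_of_le_ofReal (by positivity) (hC _ (hφ m) x)
    rw [norm_smul, Real.norm_of_nonneg ENNReal.toReal_nonneg]
    calc (EReal.exp (-φ m x)).toReal * ‖x‖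
        ≤ C * (1 + ‖x‖) ^ (-((n + 2 : ℕ) : ℝ)) * (1 + ‖x‖) := by
          gcongr
          linarith
      _ = C * ((1 + ‖x‖) ^ (-((n + 2 : ℕ) : ℝ)) * (1 + ‖x‖) ^ (1 : ℝ)) := by
          rw [Real.rpow_one, mul_assoc]
      _ = _ := by
          rw [← Real.rpow_add hy]
          congr 2
          push_cast
          ring
  · filter_upwards [ae_tendsto_of_tendsto hlim fun m => (hφ m).1] with x hx
    have hne : EReal.exp (-ψ x) ≠ ⊤ := ((hC _ hψ x).trans_lt ENNReal.ofReal_lt_top).ne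
    exact ((ENNReal.tendsto_toReal hne).comp ((ENNReal.continuous_exp.tendsto _).comp
      ((continuous_neg.tendsto _).comp hx))).smul_const x

/-! ### The three classes -/

theorem S1_eq_sublevelClass [NeZero n] : S1 n = sublevelClass n 0 1 (2 * n) n := by
  ext φ
  constructor
  · rintro ⟨⟨⟨hconv, -, -⟩, hpos, h0⟩, ht⟩
    exact ⟨hconv, hpos, by simp [h0], ht⟩
  · rintro ⟨hconv, hpos, h0, ht⟩
    have h0' : φ 0 = 0 := le_antisymm (by simpa using h0) (hpos 0)
    exact ⟨⟨⟨hconv, fun x hx => by simpa [hx] using hpos x, 0, by simp [h0']⟩, hpos, h0'⟩, ht⟩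

/-- Near-minimizers lie in the ball of radius `2n`, so `inf φ = 0` becomes a family of conditions of
hitting compact sets, each closed in `τ`. Properness and the mass bounds are automatic. -/
theorem S2_eq_sublevelClass_inter [NeZero n] : S2 n = sublevelClass n n (2 * n) (2 * n) n ∩
    ⋂ ε : {ε : ℝ // 0 < ε},
      {φ | (φ.epi ∩ Metric.closedBall (0 : E n) (2 * n) ×ˢ Icc 0 ε.1).Nonempty} := by
  have hn : (0 : ℝ) < n := Nat.cast_pos.2 (NeZero.pos n)
  ext φ
  constructor
  · rintro ⟨⟨⟨hconv, -, -⟩, -⟩, t, ht0, htn, hball, hsub, hinf, h0, h0n⟩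
    refine ⟨⟨hconv, fun x => hinf ▸ iInf_le _ x, h0n, t, ht0, htn, hball, hsub⟩, mem_iInter.2 ?_⟩
    rintro ⟨ε, hε⟩
    -- Capping at `2n` keeps the near-minimizer inside the bounded sub-level set.
    have hε' : 0 < min ε (2 * n) := lt_min hε (by positivity)
    obtain ⟨x, hx⟩ := iInf_lt_iff.1 (hinf.trans_lt (EReal.coe_pos.2 hε'))
    exact ⟨(x, min ε (2 * n)), hx.le,
      hsub (hx.le.trans (EReal.coe_le_coe_iff.2 (min_le_right _ _))), hε'.le, min_le_left _ _⟩
  · rintro ⟨hφ, hε⟩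
    have hmass := And.intro (mass_pos_of_mem_sublevelClass hφ)
      (mass_lt_top_of_mem_sublevelClass (by linarith) (by positivity) (by positivity) hφ)
    obtain ⟨hconv, hpos, h0, t, ht0, htn, hball, hsub⟩ := hφ
    refine ⟨⟨⟨hconv, fun x hx => by simpa [hx] using hpos x, 0,
      (h0.trans_lt (EReal.coe_lt_top _)).ne⟩, hmass⟩, t, ht0, htn, hball, hsub, ?_, hpos 0, h0⟩
    refine le_antisymm (EReal.le_of_forall_lt_iff_le.1 fun ε hε0 => ?_) (le_iInf hpos)
    obtain ⟨p, hp, -, hp2⟩ := mem_iInter.1 hε ⟨ε, EReal.coe_pos.1 hε0⟩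
    exact (iInf_le _ p.1).trans (le_trans hp (EReal.coe_le_coe_iff.2 hp2.2))

theorem isClosed_S1 (n : ℕ) [NeZero n] : IsClosed (S1 n) := by
  rw [S1_eq_sublevelClass]
  exact isClosed_sublevelClass one_pos

theorem isClosed_S1c (n : ℕ) [NeZero n] : IsClosed (S1c n) := by
  have hn : (0 : ℝ) < n := Nat.cast_pos.2 (NeZero.pos n)
  refine IsSeqClosed.isClosed fun φ ψ hφ hlim => ⟨?_, ?_⟩
  · exact (isClosed_S1 n).mem_of_tendsto hlim (Eventually.of_forall fun m => (hφ m).1)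
  · have h1 := tendsto_moment_of_mem_sublevelClass one_pos zero_le_one (by positivity)
      (fun m => S1_eq_sublevelClass (n := n) ▸ (hφ m).1) hlim
    exact tendsto_nhds_unique h1 (by simp [fun m => (hφ m).2])

theorem isClosed_S2 (n : ℕ) [NeZero n] : IsClosed (S2 n) := by
  have hn : (0 : ℝ) < n := Nat.cast_pos.2 (NeZero.pos n)
  rw [S2_eq_sublevelClass_inter]
  refine (isClosed_sublevelClass (by linarith)).inter (isClosed_iInter fun ε => ?_)
  simp only [nonempty_iff_ne_empty]
  exact (isOpen_setOf_epi_inter_eq_empty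
    ((isCompact_closedBall 0 _).prod isCompact_Icc)).isClosed_compl

end BlaschkeSantalo

theorem mainTheorem6 (n : ℕ) [NeZero n] :
    (IsClosed (BlaschkeSantalo.S1 n) ∧ IsCompact (BlaschkeSantalo.S1 n)) ∧
    (IsClosed (BlaschkeSantalo.S1c n) ∧ IsCompact (BlaschkeSantalo.S1c n)) ∧
    (IsClosed (BlaschkeSantalo.S2 n) ∧ IsCompact (BlaschkeSantalo.S2 n)) :=
  ⟨⟨BlaschkeSantalo.isClosed_S1 n, (BlaschkeSantalo.isClosed_S1 n).isCompact⟩,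
    ⟨BlaschkeSantalo.isClosed_S1c n, (BlaschkeSantalo.isClosed_S1c n).isCompact⟩,
    ⟨BlaschkeSantalo.isClosed_S2 n, (BlaschkeSantalo.isClosed_S2 n).isCompact⟩⟩
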